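/- Let $A\in\mathbb R^{n\times n}$, $B\in\mathbb R^{n\times p}$, $C\in\mathbb R^{p\times n}$, and consider $N$ identical linear systems $$\dot x_k = A x_k + B u_k,\qquad y_k = C x_k,\qquad k=1,\dots,N,$$ with the static diffusive output coupling $u_k=\sum_{j=1}^N a_{kj}(t)(y_j-y_k)$. Here $(a_{kj}(t))_{k,j}$, $t\ge 0$, is the weighted adjacency matrix of a time-varying digraph without self-cycles ($a_{kk}(t)=0$) such that, for some constants $0<\eta\le\gamma$, $a_{kj}(t)\in\{0\}\cup[\eta,\gamma]$ for all $k,j$ and all $t\ge0$; node $j$ is a neighbor of node $k$ at time $t$ if $a_{kj}(t)\ge\eta$. Let $L(t)$ be the graph Laplacian, $l_{kk}=\sum_i a_{ki}$ and $l_{kj}=-a_{kj}$ for $j\neq k$, and assume that $L(t)$ is piecewise continuous and bounded on $[0,\infty)$. Terminology. $(A,B,C)$ is passive if there is a symmetric positive definite $P$ with $PA+A^{T}P\le 0$ and $B^{T}P=C$. $(A,C)$ is observable if $Ce^{tA}v=0$ for all $t\ge 0$ implies $v=0$; $(A,B,C)$ is called observable if $(A,C)$ is. The graph is connected at time $t$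 if there is a node $k$ that every node $j$ reaches by a path in which each vertex is followed by one of its neighbors; it is balanced at time $t$ if $\sum_j a_{kj}(t)=\sum_j a_{jk}(t)$ for every $k$; it is symmetric at time $t$ if $a_{kj}(t)=a_{jk}(t)$ for all $k,j$. Write $\Pi=I_N-\frac1N 1_N1_N^{T}$. Assume that one of the following holds. A1. $(A,B,C)$ is passive and observable, and the graph is connected and balanced at every time $t\ge 0$. A2. $(A,B,C)$ is passive and observable, the graph is symmetric at every time $t\ge 0$, its Laplacian is factorized as $L(t)=D(t)D(t)^{T}$ for $t\ge0$ with some $D(t)\in\mathbb R^{N\times M}$, and the pair $\bigl(I_N\otimes A,\;(D(t)\otimes I_p)^{T}(I_N\otimes C)\bigr)$ is uniformly observable modulo the synchronization subspace $\{1_N\otimes v: v\in\mathbb R^n\}$; that is, there are $T,\alpha>0$ such that for all $t_0>0$ $$\int_{t_0}^{t_0+T}\Phi(t,t_0)^{T}(I_N\otimes C)^{T}(D(t)\otimes I_p)(D(t)\otimes I_p)^{T}(I_N\otimes C)\Phi(t,t_0)\,dt\;\ge\;\alpha\,(\Pi\otimes I_n),\qquad \Phi(t,t_0)=e^{(t-t_0)(I_N\otimes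 A)}.$$ Then the closed-loop solutions exponentially synchronize to a solution of $\dot x_0=Ax_0$: there are constants $\delta_1,\delta_2>0$ such that for every $t_0\ge 0$ and every closed-loop solution $x=(x_1,\dots,x_N)$ on $[t_0,\infty)$ there is a solution $x_0$ of $\dot x_0=Ax_0$ with $$\Bigl(\sum_{k=1}^N\|x_k(t)-x_0(t)\|^2\Bigr)^{1/2}\le \delta_1 e^{-\delta_2(t-t_0)}\Bigl(\sum_{k=1}^N\|x_k(t_0)-x_0(t_0)\|^2\Bigr)^{1/2}\qquad\text{for all } t\ge t_0.$$ -/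

import Mathlib

open Set Filter Topology
open scoped Matrix Kronecker

noncomputable section

/-- A time-varying weighted digraph on the nodes `0, …, N - 1`. The entry `adj t k j` is the weight
`a_{kj}(t)` with which node `k` listens to node `j`. Only times `t ≥ 0` matter. Weights are either
zero or in a fixed interval `[η, γ]` with `0 < η`, and there are no self-cycles. -/
structure CommGraph (N : ℕ) where
  adj : ℝ → Matrix (Fin N) (Fin N) ℝ
  η : ℝ
  γ : ℝ
  η_pos : 0 < η
  η_le_γ : η ≤ γ
  adj_range : ∀ t, 0 ≤ t → ∀ k j, adj t k j = 0 ∨ adj t k j ∈ Icc η γ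
  no_loops : ∀ t, 0 ≤ t → ∀ k, adj t k k = 0

namespace CommGraph

variable {N : ℕ} (G : CommGraph N)

/-- The Laplacian: `l_{kk} = ∑ i, a_{ki}` and `l_{kj} = -a_{kj}` for `j ≠ k`. -/
def laplacian (t : ℝ) : Matrix (Fin N) (Fin N) ℝ :=
  Matrix.of fun k j => if j = k then ∑ i, G.adj t k i else -G.adj t k j

/-- In-degree equals out-degree at every node. -/
def Balanced (t : ℝ) : Prop :=
  ∀ k, ∑ j, G.adj t k j = ∑ j, G.adj t j k

/-- `v` is a neighbor of `u` at time `t`. -/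
def Neighbor (t : ℝ) (u v : Fin N) : Prop :=
  G.η ≤ G.adj t u v

/-- Some node `k` is reached from every node by a path in which each vertex is followed by one of
its neighbors. -/
def Connected (t : ℝ) : Prop :=
  ∃ k, ∀ j, Relation.ReflTransGen (G.Neighbor t) j k

/-- The weighted graph is undirected at time `t`. -/
def Symmetric (t : ℝ) : Prop :=
  (G.adj t).IsSymm

end CommGraph

/-- Piecewise continuity on `[0, ∞)`: finitely many breakpoints in every bounded interval,
continuity elsewhere, and finite one-sided limits at the breakpoints. -/
def PiecewiseContinuous {X : Type*} [TopologicalSpace X] (f : ℝ → X) : Prop :=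
  ∃ S : Set ℝ, (∀ T : ℝ, (S ∩ Icc 0 T).Finite) ∧
    (∀ t, 0 ≤ t → t ∉ S → ContinuousWithinAt f (Ici 0) t) ∧
    (∀ t, 0 ≤ t → t ∈ S → ∃ l, Tendsto f (𝓝[>] t) (𝓝 l)) ∧
    (∀ t, 0 < t → t ∈ S → ∃ l, Tendsto f (𝓝[<] t) (𝓝 l))

/-- Passivity of `(A, B, C)`: there is a symmetric `P > 0` with `P A + Aᵀ P ≤ 0` and `Bᵀ P = C`. -/
def IsPassive {n p : ℕ} (A : Matrix (Fin n) (Fin n) ℝ) (B : Matrix (Fin n) (Fin p) ℝ)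
    (C : Matrix (Fin p) (Fin n) ℝ) : Prop :=
  ∃ P : Matrix (Fin n) (Fin n) ℝ,
    P.PosDef ∧ (-(P * A + Aᵀ * P)).PosSemidef ∧ Bᵀ * P = C

/-- Observability of `(A, C)`: only the zero initial state produces the zero output of
`ẋ = A x`, `y = C x`. -/
def IsObservable {n p : ℕ} (A : Matrix (Fin n) (Fin n) ℝ) (C : Matrix (Fin p) (Fin n) ℝ) : Prop :=
  ∀ v : Fin n → ℝ, (∀ t : ℝ, 0 ≤ t → C *ᵥ (NormedSpace.exp (t • A) *ᵥ v) = 0) → v = 0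

/-- The observability Gramian of `ẋ = F x`, `z = H(t) x` over `[t₀, t₀ + T]`, that is, the
(entrywise) integral of `Φ(t, t₀)ᵀ H(t)ᵀ H(t) Φ(t, t₀)` with `Φ(t, t₀) = exp ((t - t₀) F)`. -/
def obsGramian {ι κ : Type*} [Fintype ι] [DecidableEq ι] [Fintype κ]
    (F : Matrix ι ι ℝ) (H : ℝ → Matrix κ ι ℝ) (t₀ T : ℝ) : Matrix ι ι ℝ :=
  Matrix.of fun i j => ∫ t in t₀..(t₀ + T),
    ((H t * NormedSpace.exp ((t - t₀) • F))ᵀ * (H t * NormedSpace.exp ((t - t₀) • F))) i j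

/-- Uniform observability of `(F, H(t))` relative to a symmetric idempotent matrix `Q`: there are
`T, α > 0` such that, for every `t₀ > 0`, the Gramian over `[t₀, t₀ + T]` is at least `α Q`.
For `Q = 1` this is the usual uniform observability; in general it is uniform observability
modulo the kernel of `Q`. -/
def UniformlyObservableMod {ι κ : Type*} [Fintype ι] [DecidableEq ι] [Fintype κ]
    (F : Matrix ι ι ℝ) (H : ℝ → Matrix κ ι ℝ) (Q : Matrix ι ι ℝ) : Prop :=
  ∃ T > 0, ∃ α > 0, ∀ t₀ : ℝ, 0 < t₀ → (obsGramian F H t₀ T - α • Q).PosSemidef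

/-- The projector `Π = I_N - (1/N) 1_N 1_Nᵀ` onto the orthogonal complement of `1_N`. -/
def disagreementProj (N : ℕ) : Matrix (Fin N) (Fin N) ℝ :=
  1 - (1 / (N : ℝ)) • Matrix.of fun _ _ => 1

/-- `x = (x_k)` is a solution on `[t₀, ∞)` of `ẋ_k = A x_k + B u_k`, `y_k = C x_k` with
`u_k = ∑ j, a_{kj}(t) (y_j - y_k)`: it is continuous and satisfies the differential equation at
every `t > t₀` at which the weights are continuous. -/
def IsClosedLoopSolution {n p N : ℕ} (A : Matrix (Fin n) (Fin n) ℝ) (B : Matrix (Fin n) (Fin p) ℝ)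
    (C : Matrix (Fin p) (Fin n) ℝ) (G : CommGraph N) (t₀ : ℝ) (x : ℝ → Fin N → Fin n → ℝ) : Prop :=
  ContinuousOn x (Ici t₀) ∧
    ∀ t, t₀ < t → ContinuousAt G.adj t → ∀ k,
      HasDerivAt (fun s => x s k)
        (A *ᵥ x t k + B *ᵥ ∑ j, G.adj t k j • (C *ᵥ x t j - C *ᵥ x t k)) t

/-- The Euclidean norm of the stacked vector `[z_1ᵀ, …, z_Nᵀ]ᵀ`. -/
def stackNorm {n N : ℕ} (z : Fin N → Fin n → ℝ) : ℝ :=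
  √(∑ k, ∑ i, z k i ^ 2)

/-- The closed-loop solutions synchronize exponentially to solutions of `ẋ₀ = A x₀`, with constants
`δ₁, δ₂` that depend neither on the initial time nor on the solution. -/
def ExponentiallySynchronizes {n p N : ℕ} (A : Matrix (Fin n) (Fin n) ℝ)
    (B : Matrix (Fin n) (Fin p) ℝ) (C : Matrix (Fin p) (Fin n) ℝ) (G : CommGraph N) : Prop :=
  ∃ δ₁ > 0, ∃ δ₂ > 0, ∀ t₀ : ℝ, 0 ≤ t₀ → ∀ x : ℝ → Fin N → Fin n → ℝ,
    IsClosedLoopSolution A B C G t₀ x →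
      ∃ x₀ : ℝ → Fin n → ℝ, (∀ t, HasDerivAt x₀ (A *ᵥ x₀ t) t) ∧
        ∀ t, t₀ ≤ t → stackNorm (fun k => x t k - x₀ t) ≤
          δ₁ * Real.exp (-δ₂ * (t - t₀)) * stackNorm (fun k => x t₀ k - x₀ t₀)

end

/-! Subtract from all agents the free motion `x₀` started at their mean. Balance keeps the mean of
the errors `e` at zero, and passivity makes `V = ∑ k, e_kᵀ P e_k` decrease at least at the rate of
the output disagreement `∑ a_{kj} |y_j - y_k|²`. It remains to bound this dissipation over a window
of fixed length below by a multiple of `V`. For free motions of zero mean this is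
`UniformlyExciting`. It passes to the closed loop because the inputs, and hence the deviation from
the free motion with the same initial state, are controlled by the dissipated energy itself
(`exists_storage_sub_free_le`). So `V` contracts by a fixed factor over each window
(`UniformlyExciting.exists_contraction`), and iteration gives exponential decay. Excitation has two
sources. Under A1, observability bounds each state by its output energy, and a Poincaré inequality
on connected graphs bounds output energy by disagreement. Under A2, the Gramian integrand is half
the disagreement since `L = D Dᵀ`. -/

/-! ### Tools from analysis. -/

/-- Continuous functions that are homogeneous of degree two are dominated by positive ones. -/
theorem exists_le_mul_of_homogeneous {X : Type*} [NormedAddCommGroup X] [NormedSpace ℝ X]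
    [FiniteDimensional ℝ X] {f g : X → ℝ} (hf : Continuous f) (hg : Continuous g)
    (hf2 : ∀ (c : ℝ) x, f (c • x) = c ^ 2 * f x) (hg2 : ∀ (c : ℝ) x, g (c • x) = c ^ 2 * g x)
    (hpos : ∀ x, x ≠ 0 → 0 < g x) : ∃ K > 0, ∀ x, f x ≤ K * g x := by
  have : ProperSpace X := FiniteDimensional.proper ℝ X
  have hK : IsCompact (Metric.sphere (0 : X) 1) := isCompact_sphere 0 1
  have hne : ∀ x ∈ Metric.sphere (0 : X) 1, x ≠ 0 := fun x hx h => by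
    rw [mem_sphere_zero_iff_norm, h, norm_zero] at hx
    exact zero_ne_one hx
  obtain ⟨b, hb⟩ := (hK.image_of_continuousOn (f := fun x => f x / g x)
    (hf.continuousOn.div hg.continuousOn fun x hx => (hpos x (hne x hx)).ne')).bddAbove
  refine ⟨max b 1, by positivity, fun x => ?_⟩
  by_cases hx : x = 0
  · have h1 : f 0 = 0 := by simpa using hf2 0 0
    have h2 : g 0 = 0 := by simpa using hg2 0 0
    simp [hx, h1, h2]
  · have hn : (0 : ℝ) < ‖x‖ := norm_pos_iff.mpr hx
    have hy : ‖x‖⁻¹ • x ∈ Metric.sphere (0 : X) 1 := by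
      simp [norm_smul, hn.ne']
    have h := hb ⟨_, hy, rfl⟩
    have hg0 := hpos x hx
    have : f x / g x ≤ b := by
      have e : f (‖x‖⁻¹ • x) / g (‖x‖⁻¹ • x) = f x / g x := by
        rw [hf2, hg2, mul_div_mul_left _ _ (by positivity)]
      simpa [e] using h
    rw [← div_le_iff₀ hg0]
    exact this.trans (le_max_left _ _)

/-- The integrand is bounded by compactness and continuous off a null set. The form separates the
discontinuous weights `m` from the continuous state `c`, so that all energy integrands fit. -/
theorem intervalIntegrable_comp_of_continuous_off_countable {X Y : Type*} [TopologicalSpace X]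
    [TopologicalSpace Y] {K : Set Y} (hK : IsCompact K) {S : Set ℝ} (hS : S.Countable) {a b : ℝ}
    (hab : a ≤ b) {m : ℝ → Y} {c : ℝ → X} {Ψ : Y × X → ℝ} (hm : ∀ t ∈ Icc a b, m t ∈ K)
    (hmc : ∀ t ∈ Icc a b, t ∉ S → ContinuousWithinAt m (Icc a b) t)
    (hc : ContinuousOn c (Icc a b)) (hΨ : Continuous Ψ) :
    IntervalIntegrable (fun t => Ψ (m t, c t)) MeasureTheory.volume a b := by
  rw [intervalIntegrable_iff_integrableOn_Icc_of_le hab]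
  have hae : (Icc a b \ S : Set ℝ) =ᵐ[MeasureTheory.volume] Icc a b :=
    MeasureTheory.sdiff_null_ae_eq_self (hS.measure_zero _)
  refine MeasureTheory.IntegrableOn.congr_set_ae ?_ hae.symm
  have hcont : ContinuousOn (fun t => Ψ (m t, c t)) (Icc a b \ S) := fun t ht =>
    hΨ.continuousAt.comp_continuousWithinAt
      (((hmc t ht.1 ht.2).mono sdiff_subset).prodMk ((hc t ht.1).mono sdiff_subset))
  obtain ⟨R, hR⟩ := ((hK.prod (isCompact_Icc.image_of_continuousOn hc)).image hΨ).isBounded.exists_norm_le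
  have hmeas : MeasurableSet (Icc a b \ S) := measurableSet_Icc.diff hS.measurableSet
  refine MeasureTheory.IntegrableOn.of_bound (C := R) ?_
    (hcont.aestronglyMeasurable hmeas) ?_
  · exact (MeasureTheory.measure_mono sdiff_subset).trans_lt measure_Icc_lt_top
  · filter_upwards [MeasureTheory.ae_restrict_mem hmeas] with t ht
    exact hR _ ⟨_, ⟨hm t ht.1, mem_image_of_mem c ht.1⟩, rfl⟩

/-- Differential inequalities cross the switching times in this form: at points of `S`, `f'` is just
a formula that need not be a derivative. -/
theorem sub_le_integral_of_hasDerivAt_off_countable {f f' φ : ℝ → ℝ} {S : Set ℝ}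
    (hS : S.Countable) {a b : ℝ} (hab : a ≤ b) (hf : ContinuousOn f (Icc a b))
    (hd : ∀ t ∈ Ioo a b, t ∉ S → HasDerivAt f (f' t) t)
    (hf' : IntervalIntegrable f' MeasureTheory.volume a b)
    (hφ : IntervalIntegrable φ MeasureTheory.volume a b)
    (hle : ∀ t ∈ Icc a b, f' t ≤ φ t) : f b - f a ≤ ∫ t in a..b, φ t := by
  rw [← MeasureTheory.integral_eq_of_hasDerivAt_off_countable_of_le f f' hab hS hf
    (fun t ht => hd t ht.1 ht.2) hf']
  exact intervalIntegral.integral_mono_on hab hf' hφ hle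

theorem Matrix.hasDerivAt_exp_smul_mulVec {n : ℕ} (A : Matrix (Fin n) (Fin n) ℝ) (v : Fin n → ℝ)
    (t₀ t : ℝ) : HasDerivAt (fun s : ℝ => NormedSpace.exp ((s - t₀) • A) *ᵥ v)
      (A *ᵥ (NormedSpace.exp ((t - t₀) • A) *ᵥ v)) t := by
  open scoped Matrix.Norms.Operator in
  have h := (hasDerivAt_exp_smul_const' (𝕂 := ℝ) A (t - t₀)).comp_sub_const t t₀
  have h2 := ((Matrix.mulVecBilin ℝ ℝ).flip v).toContinuousLinearMap.hasFDerivAt.comp_hasDerivAt t h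
  rw [Matrix.mulVec_mulVec]
  exact h2

theorem HasDerivAt.dotProduct_mulVec_self {n : ℕ} {P : Matrix (Fin n) (Fin n) ℝ} (hP : P.IsSymm)
    {x : ℝ → Fin n → ℝ} {x' : Fin n → ℝ} {t : ℝ} (hx : HasDerivAt x x' t) :
    HasDerivAt (fun s => x s ⬝ᵥ (P *ᵥ x s)) (2 * (x t ⬝ᵥ (P *ᵥ x'))) t := by
  have hx' := hasDerivAt_pi.mp hx
  have h : HasDerivAt (fun s => ∑ i, x s i * ∑ j, P i j * x s j)
      (∑ i, (x' i * ∑ j, P i j * x t j + x t i * ∑ j, P i j * x' j)) t := by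
    refine HasDerivAt.fun_sum fun i _ => (hx' i).mul ?_
    exact HasDerivAt.fun_sum fun j _ => (hx' j).const_mul _
  have : x' ⬝ᵥ (P *ᵥ x t) = x t ⬝ᵥ (P *ᵥ x') := by
    rw [Matrix.dotProduct_mulVec, ← Matrix.mulVec_transpose, hP.eq, dotProduct_comm]
  have e : 2 * (x t ⬝ᵥ (P *ᵥ x')) = x' ⬝ᵥ (P *ᵥ x t) + x t ⬝ᵥ (P *ᵥ x') := by rw [this]; ring
  rw [Finset.sum_add_distrib] at h
  rw [e]
  exact h

/-! ### Algebra of diffusive coupling and the storage function. -/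

/-- The diffusive coupling input `∑ j, a_{kj} (y_j - y_k)`. -/
def diffusiveCoupling {N p : ℕ} (M : Matrix (Fin N) (Fin N) ℝ) (y : Fin N → Fin p → ℝ) (k : Fin N) :
    Fin p → ℝ :=
  ∑ j, M k j • (y j - y k)

/-- The weighted disagreement `∑ k, ∑ j, a_{kj} |y_j - y_k|²`. -/
def disagreement {N p : ℕ} (M : Matrix (Fin N) (Fin N) ℝ) (y : Fin N → Fin p → ℝ) : ℝ :=
  ∑ k, ∑ j, M k j * ((y j - y k) ⬝ᵥ (y j - y k))

/-- The quadratic storage function `∑ k, e_kᵀ P e_k`. -/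
def storage {N n : ℕ} (P : Matrix (Fin n) (Fin n) ℝ) (e : Fin N → Fin n → ℝ) : ℝ :=
  ∑ k, e k ⬝ᵥ (P *ᵥ e k)

section
variable {N n p : ℕ}

theorem dotProduct_self_nonneg' (v : Fin p → ℝ) : 0 ≤ v ⬝ᵥ v :=
  Finset.sum_nonneg fun _ _ => mul_self_nonneg _

theorem two_mul_dotProduct_le (v w : Fin p → ℝ) : 2 * (v ⬝ᵥ w) ≤ v ⬝ᵥ v + w ⬝ᵥ w := by
  have h := dotProduct_self_nonneg' (v - w)
  rw [sub_dotProduct, dotProduct_sub, dotProduct_sub, dotProduct_comm w v] at h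
  linarith

theorem dotProduct_add_self_le (v w : Fin p → ℝ) :
    (v + w) ⬝ᵥ (v + w) ≤ 2 * (v ⬝ᵥ v) + 2 * (w ⬝ᵥ w) := by
  have h := two_mul_dotProduct_le v w
  rw [add_dotProduct, dotProduct_add, dotProduct_add, dotProduct_comm w v]
  linarith

theorem disagreement_nonneg {M : Matrix (Fin N) (Fin N) ℝ} (hM : ∀ k j, 0 ≤ M k j)
    (y : Fin N → Fin p → ℝ) : 0 ≤ disagreement M y :=
  Finset.sum_nonneg fun _ _ => Finset.sum_nonneg fun _ _ =>
    mul_nonneg (hM _ _) (dotProduct_self_nonneg' _)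

theorem disagreement_add_le {M : Matrix (Fin N) (Fin N) ℝ} (hM : ∀ k j, 0 ≤ M k j)
    (y z : Fin N → Fin p → ℝ) :
    disagreement M (y + z) ≤ 2 * disagreement M y + 2 * disagreement M z := by
  simp only [disagreement, Finset.mul_sum, ← Finset.sum_add_distrib]
  refine Finset.sum_le_sum fun k _ => Finset.sum_le_sum fun j _ => ?_
  have h := mul_le_mul_of_nonneg_left (dotProduct_add_self_le (y j - y k) (z j - z k)) (hM k j)
  have e : (y + z) j - (y + z) k = (y j - y k) + (z j - z k) := by
    simp only [Pi.add_apply]; abel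
  rw [e]; linarith

theorem disagreement_le {M : Matrix (Fin N) (Fin N) ℝ} {γ : ℝ} (hM : ∀ k j, M k j ≤ γ)
    (y : Fin N → Fin p → ℝ) : disagreement M y ≤ disagreement (Matrix.of fun _ _ => γ) y :=
  Finset.sum_le_sum fun _ _ => Finset.sum_le_sum fun _ _ =>
    mul_le_mul_of_nonneg_right (hM _ _) (dotProduct_self_nonneg' _)

theorem disagreement_smul (M : Matrix (Fin N) (Fin N) ℝ) (c : ℝ) (y : Fin N → Fin p → ℝ) :
    disagreement M (c • y) = c ^ 2 * disagreement M y := by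
  simp only [disagreement, Finset.mul_sum, Pi.smul_apply, ← smul_sub, smul_dotProduct,
    dotProduct_smul, smul_eq_mul]
  exact Finset.sum_congr rfl fun _ _ => Finset.sum_congr rfl fun _ _ => by ring

theorem storage_smul (P : Matrix (Fin n) (Fin n) ℝ) (c : ℝ) (e : Fin N → Fin n → ℝ) :
    storage P (c • e) = c ^ 2 * storage P e := by
  simp only [storage, Finset.mul_sum, Pi.smul_apply, Matrix.mulVec_smul, smul_dotProduct,
    dotProduct_smul, smul_eq_mul]
  exact Finset.sum_congr rfl fun _ _ => by ring

theorem storage_nonneg {P : Matrix (Fin n) (Fin n) ℝ} (hP : P.PosDef) (e : Fin N → Fin n → ℝ) :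
    0 ≤ storage P e :=
  Finset.sum_nonneg fun k _ => by
    simpa using hP.posSemidef.dotProduct_mulVec_nonneg (e k)

theorem storage_pos {P : Matrix (Fin n) (Fin n) ℝ} (hP : P.PosDef) {e : Fin N → Fin n → ℝ}
    (he : e ≠ 0) : 0 < storage P e := by
  obtain ⟨k, hk⟩ := Function.ne_iff.mp he
  refine Finset.sum_pos' (fun k _ => ?_) ⟨k, Finset.mem_univ _, ?_⟩
  · simpa using hP.posSemidef.dotProduct_mulVec_nonneg (e k)
  · simpa using hP.dotProduct_mulVec_pos hk

theorem continuous_storage (P : Matrix (Fin n) (Fin n) ℝ) :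
    Continuous (storage P : (Fin N → Fin n → ℝ) → ℝ) := by
  unfold storage; simp only [dotProduct, Matrix.mulVec]; fun_prop

theorem continuous_disagreement :
    Continuous fun q : Matrix (Fin N) (Fin N) ℝ × (Fin N → Fin p → ℝ) =>
      disagreement q.1 q.2 := by
  unfold disagreement; simp only [dotProduct]; fun_prop

theorem sum_diffusiveCoupling {M : Matrix (Fin N) (Fin N) ℝ}
    (hM : ∀ k, ∑ j, M k j = ∑ j, M j k) (y : Fin N → Fin p → ℝ) :
    ∑ k, diffusiveCoupling M y k = 0 := by
  simp only [diffusiveCoupling, smul_sub, Finset.sum_sub_distrib]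
  rw [Finset.sum_comm]
  simp only [← Finset.sum_smul, hM, sub_self]

/-- After expanding the squares, balance makes the sums of `a_{kj} |y_j|²` and `a_{kj} |y_k|²`
equal; no symmetry of the weights is needed. -/
theorem two_mul_sum_dotProduct_diffusiveCoupling {M : Matrix (Fin N) (Fin N) ℝ}
    (hM : ∀ k, ∑ j, M k j = ∑ j, M j k) (y : Fin N → Fin p → ℝ) :
    2 * ∑ k, y k ⬝ᵥ diffusiveCoupling M y k = -disagreement M y := by
  have h1 : ∑ k, ∑ j, M k j * (y j ⬝ᵥ y j) = ∑ k, ∑ j, M k j * (y k ⬝ᵥ y k) := by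
    rw [Finset.sum_comm]
    simp only [← Finset.sum_mul, hM]
  have h2 : disagreement M y = ∑ k, ∑ j, M k j * (y j ⬝ᵥ y j)
      + ∑ k, ∑ j, M k j * (y k ⬝ᵥ y k) - 2 * ∑ k, ∑ j, M k j * (y k ⬝ᵥ y j) := by
    simp only [disagreement, Finset.mul_sum, ← Finset.sum_add_distrib, ← Finset.sum_sub_distrib]
    refine Finset.sum_congr rfl fun k _ => Finset.sum_congr rfl fun j _ => ?_
    rw [sub_dotProduct, dotProduct_sub, dotProduct_sub, dotProduct_comm (y j) (y k)]
    ring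
  have h3 : ∑ k, y k ⬝ᵥ diffusiveCoupling M y k
      = ∑ k, ∑ j, M k j * (y k ⬝ᵥ y j) - ∑ k, ∑ j, M k j * (y k ⬝ᵥ y k) := by
    simp only [diffusiveCoupling, dotProduct_sum, dotProduct_smul, dotProduct_sub, smul_eq_mul,
      mul_sub, Finset.sum_sub_distrib]
  rw [h3, h2, h1]; ring

/-- Cauchy–Schwarz together with `a² ≤ γ a`: the input energy is controlled by the dissipation. -/
theorem sum_diffusiveCoupling_dotProduct_self_le {M : Matrix (Fin N) (Fin N) ℝ} {γ : ℝ}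
    (h0 : ∀ k j, 0 ≤ M k j) (hγ : ∀ k j, M k j ≤ γ) (y : Fin N → Fin p → ℝ) :
    ∑ k, diffusiveCoupling M y k ⬝ᵥ diffusiveCoupling M y k ≤ N * γ * disagreement M y := by
  simp only [disagreement, Finset.mul_sum]
  refine Finset.sum_le_sum fun k _ => ?_
  have h : ∀ i, diffusiveCoupling M y k i * diffusiveCoupling M y k i
      ≤ ∑ j, N * γ * (M k j * ((y j - y k) i * (y j - y k) i)) := fun i => by
    have hs := sq_sum_le_card_mul_sum_sq (s := Finset.univ)
      (f := fun j => M k j * (y j - y k) i)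
    have e : diffusiveCoupling M y k i = ∑ j, M k j * (y j - y k) i := by
      simp [diffusiveCoupling, Finset.sum_apply]
    rw [e, ← sq]
    refine hs.trans ?_
    rw [Finset.card_univ, Fintype.card_fin, Finset.mul_sum]
    refine Finset.sum_le_sum fun j _ => ?_
    have h1 : M k j * M k j ≤ γ * M k j := mul_le_mul_of_nonneg_right (hγ k j) (h0 k j)
    have h2 := mul_le_mul_of_nonneg_right h1 (mul_self_nonneg ((y j - y k) i))
    have h3 := mul_le_mul_of_nonneg_left h2 (Nat.cast_nonneg (α := ℝ) N)
    nlinarith [h3]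
  calc diffusiveCoupling M y k ⬝ᵥ diffusiveCoupling M y k
      ≤ ∑ i, ∑ j, N * γ * (M k j * ((y j - y k) i * (y j - y k) i)) :=
        Finset.sum_le_sum fun i _ => h i
    _ = _ := by
        rw [Finset.sum_comm]
        simp only [dotProduct, Finset.mul_sum]

theorem IsPassive.exists_storage {A : Matrix (Fin n) (Fin n) ℝ} {B : Matrix (Fin n) (Fin p) ℝ}
    {C : Matrix (Fin p) (Fin n) ℝ} (h : IsPassive A B C) :
    ∃ P : Matrix (Fin n) (Fin n) ℝ, P.PosDef ∧ P.IsSymm ∧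
      ∀ v u, 2 * (v ⬝ᵥ (P *ᵥ (A *ᵥ v + B *ᵥ u))) ≤ 2 * ((C *ᵥ v) ⬝ᵥ u) := by
  obtain ⟨P, hP, hPA, hPB⟩ := h
  have hs : Pᵀ = P := by simpa using hP.isHermitian.eq
  refine ⟨P, hP, hs, fun v u => ?_⟩
  have h1 : 0 ≤ v ⬝ᵥ (-(P * A + Aᵀ * P) *ᵥ v) := by
    simpa using hPA.dotProduct_mulVec_nonneg v
  have h2 : v ⬝ᵥ ((Aᵀ * P) *ᵥ v) = v ⬝ᵥ ((P * A) *ᵥ v) := by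
    rw [Matrix.dotProduct_mulVec v (P * A), ← Matrix.mulVec_transpose, Matrix.transpose_mul, hs,
      dotProduct_comm]
  have h3 : v ⬝ᵥ (P *ᵥ (B *ᵥ u)) = (C *ᵥ v) ⬝ᵥ u := by
    rw [Matrix.mulVec_mulVec, Matrix.dotProduct_mulVec, ← Matrix.mulVec_transpose,
      Matrix.transpose_mul, hs, hPB]
  rw [Matrix.neg_mulVec, Matrix.add_mulVec, dotProduct_neg, dotProduct_add, h2] at h1
  rw [Matrix.mulVec_add, dotProduct_add, h3, Matrix.mulVec_mulVec]
  linarith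

end

/-! ### Regularity of the weights in time. -/

namespace CommGraph

variable {N : ℕ} (G : CommGraph N)

theorem adj_nonneg {t : ℝ} (ht : 0 ≤ t) (k j : Fin N) : 0 ≤ G.adj t k j := by
  rcases G.adj_range t ht k j with h | h
  · exact h.ge
  · exact G.η_pos.le.trans h.1

theorem adj_le {t : ℝ} (ht : 0 ≤ t) (k j : Fin N) : G.adj t k j ≤ G.γ := by
  rcases G.adj_range t ht k j with h | h
  · exact h.le.trans (G.η_pos.le.trans G.η_le_γ)
  · exact h.2

theorem γ_pos : 0 < G.γ := G.η_pos.trans_le G.η_le_γ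

/-- The weights are continuous off a countable set of times. -/
def BreakpointsIn (S : Set ℝ) : Prop :=
  S.Countable ∧ ∀ t, 0 ≤ t → t ∉ S → ContinuousWithinAt G.adj (Ici 0) t

theorem exists_breakpointsIn (h : PiecewiseContinuous G.laplacian) : ∃ S, G.BreakpointsIn S := by
  obtain ⟨S, hfin, hS, -, -⟩ := h
  refine ⟨⋃ m : ℕ, S ∩ Icc 0 (m : ℝ), countable_iUnion fun m => (hfin m).countable,
    fun t ht htS => ?_⟩
  have htS' : t ∉ S := fun h => by
    obtain ⟨m, hm⟩ := exists_nat_ge t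
    exact htS (mem_iUnion.mpr ⟨m, h, ht, hm⟩)
  have hc := hS t ht htS'
  refine tendsto_pi_nhds.mpr fun k => tendsto_pi_nhds.mpr fun j => ?_
  have hkj : ContinuousWithinAt (fun s => G.laplacian s k j) (Ici 0) t :=
    tendsto_pi_nhds.mp (tendsto_pi_nhds.mp hc k) j
  by_cases hjk : j = k
  · subst hjk
    exact (continuousWithinAt_const (b := (0 : ℝ))).congr (fun s hs => G.no_loops s hs j)
      (G.no_loops t ht j)
  · refine hkj.neg.congr (fun s _ => ?_) ?_ <;> simp [laplacian, hjk]

variable {G}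

theorem BreakpointsIn.continuousAt {S : Set ℝ} (hS : G.BreakpointsIn S) {t : ℝ} (ht : 0 < t)
    (htS : t ∉ S) : ContinuousAt G.adj t :=
  (hS.2 t ht.le htS).continuousAt (Ici_mem_nhds ht)

theorem BreakpointsIn.intervalIntegrable {S : Set ℝ} (hS : G.BreakpointsIn S) {X : Type*}
    [TopologicalSpace X] {a b : ℝ} (ha : 0 ≤ a) (hab : a ≤ b) {c : ℝ → X}
    (hc : ContinuousOn c (Icc a b)) {Ψ : Matrix (Fin N) (Fin N) ℝ × X → ℝ} (hΨ : Continuous Ψ) :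
    IntervalIntegrable (fun t => Ψ (G.adj t, c t)) MeasureTheory.volume a b := by
  refine intervalIntegrable_comp_of_continuous_off_countable
    (K := Set.pi univ fun _ : Fin N => Set.pi univ fun _ : Fin N => Icc 0 G.γ)
    (isCompact_univ_pi fun _ => isCompact_univ_pi fun _ => isCompact_Icc) hS.1 hab
    (fun t ht k _ j _ => ⟨G.adj_nonneg (ha.trans ht.1) k j, G.adj_le (ha.trans ht.1) k j⟩)
    (fun t ht htS => (hS.2 t (ha.trans ht.1) htS).mono fun s hs => ha.trans hs.1) hc hΨ

end CommGraph

/-! ### Energy balance and comparison with free motion. -/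

section
variable {n p N : ℕ} {A : Matrix (Fin n) (Fin n) ℝ} {B : Matrix (Fin n) (Fin p) ℝ}
  {C : Matrix (Fin p) (Fin n) ℝ} {G : CommGraph N} {S : Set ℝ} {P : Matrix (Fin n) (Fin n) ℝ}

theorem IsClosedLoopSolution.hasDerivAt {t₀ : ℝ} {e : ℝ → Fin N → Fin n → ℝ}
    (he : IsClosedLoopSolution A B C G t₀ e) (hS : G.BreakpointsIn S) (ht₀ : 0 ≤ t₀) {t : ℝ}
    (ht : t₀ < t) (htS : t ∉ S) (k : Fin N) :
    HasDerivAt (fun s => e s k)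
      (A *ᵥ e t k + B *ᵥ diffusiveCoupling (G.adj t) (fun j => C *ᵥ e t j) k) t :=
  he.2 t ht (hS.continuousAt (ht₀.trans_lt ht) htS) k

/-- The coupling sees only differences of outputs, so a common free motion drops out. -/
theorem IsClosedLoopSolution.sub_free {t₀ : ℝ} {x : ℝ → Fin N → Fin n → ℝ}
    (hx : IsClosedLoopSolution A B C G t₀ x) {x₀ : ℝ → Fin n → ℝ}
    (hx₀ : ∀ t, HasDerivAt x₀ (A *ᵥ x₀ t) t) :
    IsClosedLoopSolution A B C G t₀ fun t k => x t k - x₀ t := by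
  have hc : Continuous x₀ := continuous_iff_continuousAt.mpr fun t => (hx₀ t).continuousAt
  refine ⟨hx.1.sub (g := fun t _ => x₀ t) (continuous_pi fun _ => hc).continuousOn,
    fun t ht hG k => ?_⟩
  refine ((hx.2 t ht hG k).fun_sub (hx₀ t)).congr_deriv ?_
  simp only [Matrix.mulVec_sub, sub_sub_sub_cancel_right]
  abel

theorem IsClosedLoopSolution.storage_sub_le {t₀ : ℝ} {e : ℝ → Fin N → Fin n → ℝ}
    (he : IsClosedLoopSolution A B C G t₀ e) (hS : G.BreakpointsIn S) (ht₀ : 0 ≤ t₀)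
    (hP : P.IsSymm) (hPu : ∀ v u, 2 * (v ⬝ᵥ (P *ᵥ (A *ᵥ v + B *ᵥ u))) ≤ 2 * ((C *ᵥ v) ⬝ᵥ u))
    (hbal : ∀ t, 0 ≤ t → G.Balanced t) {a b : ℝ} (ha : t₀ ≤ a) (hab : a ≤ b) :
    storage P (e b) - storage P (e a) ≤
      ∫ t in a..b, -disagreement (G.adj t) (fun k => C *ᵥ e t k) := by
  have hc : ContinuousOn e (Icc a b) := he.1.mono fun t ht => ha.trans ht.1
  have h0 : 0 ≤ a := ht₀.trans ha
  refine sub_le_integral_of_hasDerivAt_off_countable hS.1 hab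
    (f := fun t => storage P (e t))
    (f' := fun t => ∑ k, 2 * (e t k ⬝ᵥ (P *ᵥ
      (A *ᵥ e t k + B *ᵥ diffusiveCoupling (G.adj t) (fun j => C *ᵥ e t j) k))))
    ((continuous_storage P).comp_continuousOn hc) (fun t ht htS => ?_) ?_ ?_ fun t ht => ?_
  · exact HasDerivAt.fun_sum fun k _ => HasDerivAt.dotProduct_mulVec_self hP
      (he.hasDerivAt hS ht₀ (ha.trans_lt ht.1) htS k)
  · refine hS.intervalIntegrable h0 hab hc
      (Ψ := fun q => ∑ k, 2 * (q.2 k ⬝ᵥ (P *ᵥ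
        (A *ᵥ q.2 k + B *ᵥ diffusiveCoupling q.1 (fun j => C *ᵥ q.2 j) k)))) ?_
    simp only [diffusiveCoupling, dotProduct, Matrix.mulVec, Pi.add_apply, Finset.sum_apply]
    fun_prop
  · refine hS.intervalIntegrable h0 hab hc
      (Ψ := fun q => -disagreement q.1 (fun j => C *ᵥ q.2 j)) ?_
    simp only [disagreement, dotProduct]
    fun_prop
  · rw [← two_mul_sum_dotProduct_diffusiveCoupling (hbal t (h0.trans ht.1)), Finset.mul_sum]
    exact Finset.sum_le_sum fun k _ => hPu _ _

theorem intervalIntegral_neg_disagreement_nonpos {a b : ℝ} (ha : 0 ≤ a) (hab : a ≤ b)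
    (y : ℝ → Fin N → Fin p → ℝ) : ∫ t in a..b, -disagreement (G.adj t) (y t) ≤ 0 := by
  rw [intervalIntegral.integral_neg, neg_nonpos]
  exact intervalIntegral.integral_nonneg hab fun t ht =>
    disagreement_nonneg (G.adj_nonneg (ha.trans ht.1)) _

/-- A closed-loop trajectory stays close to the free motion from the same state, up to the energy
that it dissipates. -/
theorem exists_storage_sub_free_le (hS : G.BreakpointsIn S) (hPp : P.PosDef) (hP : P.IsSymm)
    (hPu : ∀ v u, 2 * (v ⬝ᵥ (P *ᵥ (A *ᵥ v + B *ᵥ u))) ≤ 2 * ((C *ᵥ v) ⬝ᵥ u))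
    (hbal : ∀ t, 0 ≤ t → G.Balanced t) (T : ℝ) :
    ∃ K ≥ 0, ∀ t₀, 0 ≤ t₀ → ∀ e, IsClosedLoopSolution A B C G t₀ e → ∀ a b, t₀ ≤ a → a ≤ b →
      b ≤ a + T →
        storage P (fun k => NormedSpace.exp ((b - a) • A) *ᵥ e a k - e b k) ≤
          K * (storage P (e a) - storage P (e b)) := by
  obtain ⟨κ, hκ, hκC⟩ := exists_le_mul_of_homogeneous (X := Fin N → Fin n → ℝ)
    (f := fun r => ∑ k, (C *ᵥ r k) ⬝ᵥ (C *ᵥ r k)) (g := storage P)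
    (by simp only [dotProduct, Matrix.mulVec]; fun_prop) (continuous_storage P)
    (fun c x => by
      simp only [Finset.mul_sum, Pi.smul_apply, Matrix.mulVec_smul, smul_dotProduct,
        dotProduct_smul, smul_eq_mul]
      exact Finset.sum_congr rfl fun _ _ => by ring)
    (storage_smul P) (fun x hx => storage_pos hPp hx)
  have hγ := G.γ_pos
  -- A Gronwall constant: `κ` bounds the output energy of the deviation by its storage, and `N γ`
  -- bounds the input energy by the dissipation.
  refine ⟨Real.exp (κ * T) * (N * G.γ), by positivity, fun t₀ ht₀ e he a b ha hab hbT => ?_⟩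
  have h0 : 0 ≤ a := ht₀.trans ha
  have hc : ContinuousOn e (Icc a b) := he.1.mono fun t ht => ha.trans ht.1
  set z : ℝ → Fin N → Fin n → ℝ := fun t k => NormedSpace.exp ((t - a) • A) *ᵥ e a k with hz
  have hzd : ∀ t k, HasDerivAt (fun s => z s k) (A *ᵥ z t k) t := fun t k =>
    Matrix.hasDerivAt_exp_smul_mulVec A (e a k) a t
  have hzc : Continuous z := continuous_pi fun k =>
    continuous_iff_continuousAt.mpr fun t => (hzd t k).continuousAt
  have hrc : ContinuousOn (fun t => z t - e t) (Icc a b) := hzc.continuousOn.sub hc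
  set u : ℝ → Fin N → Fin p → ℝ := fun t => diffusiveCoupling (G.adj t) (fun j => C *ᵥ e t j)
    with hu
  let W' : ℝ → ℝ := fun t => ∑ k, 2 * ((z t - e t) k ⬝ᵥ (P *ᵥ
    (A *ᵥ (z t - e t) k + B *ᵥ (-u t k))))
  let V' : ℝ → ℝ := fun t => ∑ k, 2 * (e t k ⬝ᵥ (P *ᵥ (A *ᵥ e t k + B *ᵥ u t k)))
  have hVle : ∀ t, 0 ≤ t → V' t ≤ -disagreement (G.adj t) (fun j => C *ᵥ e t j) := fun t ht => by
    rw [← two_mul_sum_dotProduct_diffusiveCoupling (hbal t ht), Finset.mul_sum]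
    exact Finset.sum_le_sum fun k _ => hPu _ _
  have hWle : ∀ t, 0 ≤ t → W' t ≤ κ * storage P (z t - e t)
      + N * G.γ * disagreement (G.adj t) (fun j => C *ᵥ e t j) := fun t ht => by
    refine le_trans ?_ (add_le_add (hκC (z t - e t)) (sum_diffusiveCoupling_dotProduct_self_le
      (G.adj_nonneg ht) (G.adj_le ht) _))
    rw [← Finset.sum_add_distrib]
    refine Finset.sum_le_sum fun k _ => (hPu _ _).trans ?_
    refine (two_mul_dotProduct_le _ _).trans_eq ?_
    rw [neg_dotProduct, dotProduct_neg, neg_neg]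
  -- With `W` the storage of the deviation `z - e` and `D` the disagreement, `W' ≤ κ W + N γ D` and
  -- `V' ≤ -D`. Hence `exp (-κ (t - a)) W + N γ V` is nonincreasing, and `W` vanishes at `a`.
  have key := sub_le_integral_of_hasDerivAt_off_countable hS.1 hab
    (f := fun t => Real.exp (-κ * (t - a)) * storage P (z t - e t) + N * G.γ * storage P (e t))
    (f' := fun t => (Real.exp (-κ * (t - a)) * (-κ)) * storage P (z t - e t)
      + Real.exp (-κ * (t - a)) * W' t + N * G.γ * V' t) (φ := fun _ => 0)
    (((by fun_prop : Continuous fun t => Real.exp (-κ * (t - a))).continuousOn.mul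
      ((continuous_storage P).comp_continuousOn hrc)).add
      (continuousOn_const.mul ((continuous_storage P).comp_continuousOn hc)))
    (fun t ht htS => ?_) ?_ intervalIntegrable_const fun t ht => ?_
  · rw [intervalIntegral.integral_zero] at key
    have hzero : storage P (z a - e a) = 0 := by
      have : z a - e a = 0 := by
        funext k
        simp [hz]
      rw [this]
      simp [storage]
    have hexp : Real.exp (-(κ * T)) ≤ Real.exp (-κ * (b - a)) := by
      apply Real.exp_le_exp.mpr
      nlinarith
    have hW0 : 0 ≤ storage P (z b - e b) := storage_nonneg hPp _
    have h1 := mul_le_mul_of_nonneg_right hexp hW0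
    have h2 : Real.exp (-(κ * T)) * storage P (z b - e b) ≤
        N * G.γ * (storage P (e a) - storage P (e b)) := by
      simp only [hzero] at key
      linarith
    have h3 := mul_le_mul_of_nonneg_left h2 (Real.exp_pos (κ * T)).le
    rw [← mul_assoc, ← Real.exp_add, add_neg_cancel, Real.exp_zero, one_mul, ← mul_assoc] at h3
    exact h3
  · have hed := he.hasDerivAt hS ht₀ (ha.trans_lt ht.1) htS
    have hE : HasDerivAt (fun t => Real.exp (-κ * (t - a))) (Real.exp (-κ * (t - a)) * (-κ)) t := by
      have := ((hasDerivAt_id t).sub_const a).const_mul (-κ)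
      simpa using this.exp
    have hW : HasDerivAt (fun t => storage P (z t - e t)) (W' t) t :=
      HasDerivAt.fun_sum fun k _ => HasDerivAt.dotProduct_mulVec_self hP (by
        refine ((hzd t k).fun_sub (hed k)).congr_deriv ?_
        rw [Pi.sub_apply, Matrix.mulVec_sub, Matrix.mulVec_neg]
        simp only [hu]
        abel)
    have hV : HasDerivAt (fun t => storage P (e t)) (V' t) t :=
      HasDerivAt.fun_sum fun k _ => HasDerivAt.dotProduct_mulVec_self hP (hed k)
    exact (hE.mul hW).add (hV.const_mul _)
  · refine hS.intervalIntegrable h0 hab (c := fun t => (t, z t - e t, e t))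
      (continuousOn_id.prodMk (hrc.prodMk hc))
      (Ψ := fun q => (Real.exp (-κ * (q.2.1 - a)) * (-κ)) * storage P q.2.2.1
      + Real.exp (-κ * (q.2.1 - a)) * (∑ k, 2 * (q.2.2.1 k ⬝ᵥ (P *ᵥ
          (A *ᵥ q.2.2.1 k + B *ᵥ (-diffusiveCoupling q.1 (fun j => C *ᵥ q.2.2.2 j) k)))))
      + N * G.γ * (∑ k, 2 * (q.2.2.2 k ⬝ᵥ (P *ᵥ (A *ᵥ q.2.2.2 k
          + B *ᵥ diffusiveCoupling q.1 (fun j => C *ᵥ q.2.2.2 j) k))))) ?_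
    simp only [storage, diffusiveCoupling, dotProduct, Matrix.mulVec, Pi.add_apply, Pi.neg_apply,
      Finset.sum_apply]
    fun_prop
  · have ht0 := h0.trans ht.1
    have hx1 : Real.exp (-κ * (t - a)) ≤ 1 := Real.exp_le_one_iff.mpr (by
      have := ht.1
      nlinarith)
    have hx0 := Real.exp_pos (-κ * (t - a))
    have hD := disagreement_nonneg (G.adj_nonneg ht0) (fun j => C *ᵥ e t j)
    have hNγ : 0 ≤ N * G.γ := by positivity
    have i1 := mul_le_mul_of_nonneg_left (hWle t ht0) hx0.le
    have i2 := mul_le_mul_of_nonneg_left (hVle t ht0) hNγ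
    have i3 := mul_le_mul_of_nonneg_right hx1 (mul_nonneg hNγ hD)
    linarith

end

/-! ### Uniform excitation implies synchronization. -/

section
variable {n p N : ℕ} {A : Matrix (Fin n) (Fin n) ℝ} {B : Matrix (Fin n) (Fin p) ℝ}
  {C : Matrix (Fin p) (Fin n) ℝ} {G : CommGraph N} {S : Set ℝ} {P : Matrix (Fin n) (Fin n) ℝ}

/-- Free motions with zero mean are visible in the disagreement of their outputs, uniformly in
the initial time. -/
def UniformlyExciting (A : Matrix (Fin n) (Fin n) ℝ) (C : Matrix (Fin p) (Fin n) ℝ)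
    (G : CommGraph N) : Prop :=
  ∃ T > 0, ∃ c > 0, ∀ a : ℝ, 0 < a → ∀ v : Fin N → Fin n → ℝ, ∑ k, v k = 0 →
    c * ∑ k, v k ⬝ᵥ v k ≤ ∫ t in a..(a + T),
      disagreement (G.adj t) (fun k => C *ᵥ (NormedSpace.exp ((t - a) • A) *ᵥ v k))

theorem Matrix.continuous_exp_smul_mulVec (A : Matrix (Fin n) (Fin n) ℝ) (v : Fin n → ℝ) (a : ℝ) :
    Continuous fun t : ℝ => NormedSpace.exp ((t - a) • A) *ᵥ v :=
  continuous_iff_continuousAt.mpr fun t => (A.hasDerivAt_exp_smul_mulVec v a t).continuousAt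

/-- By balance the sum `m` of the states satisfies `m' = A m` off the breakpoints. Its energy `mᵀ P
m` starts at zero and cannot grow, so no uniqueness theorem for the differential equation is called
for. -/
theorem IsClosedLoopSolution.sum_eq_zero {t₀ : ℝ} {e : ℝ → Fin N → Fin n → ℝ}
    (he : IsClosedLoopSolution A B C G t₀ e) (hS : G.BreakpointsIn S) (ht₀ : 0 ≤ t₀)
    (hPp : P.PosDef) (hP : P.IsSymm)
    (hPu : ∀ v u, 2 * (v ⬝ᵥ (P *ᵥ (A *ᵥ v + B *ᵥ u))) ≤ 2 * ((C *ᵥ v) ⬝ᵥ u))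
    (hbal : ∀ t, 0 ≤ t → G.Balanced t) (h0 : ∑ k, e t₀ k = 0) {t : ℝ} (ht : t₀ ≤ t) :
    ∑ k, e t k = 0 := by
  have hc : ContinuousOn e (Icc t₀ t) := he.1.mono fun s hs => hs.1
  have hmc : ContinuousOn (fun s => ∑ k, e s k) (Icc t₀ t) :=
    (by fun_prop : Continuous fun x : Fin N → Fin n → ℝ => ∑ k, x k).comp_continuousOn hc
  have hq : Continuous fun m : Fin n → ℝ => m ⬝ᵥ (P *ᵥ m) := by
    simp only [dotProduct, Matrix.mulVec]; fun_prop
  have hq' : Continuous fun m : Fin n → ℝ => 2 * (m ⬝ᵥ (P *ᵥ (A *ᵥ m))) := by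
    simp only [dotProduct, Matrix.mulVec]; fun_prop
  have key := sub_le_integral_of_hasDerivAt_off_countable hS.1 ht
    (f := fun s => (∑ k, e s k) ⬝ᵥ (P *ᵥ ∑ k, e s k))
    (f' := fun s => 2 * ((∑ k, e s k) ⬝ᵥ (P *ᵥ (A *ᵥ ∑ k, e s k)))) (φ := fun _ => 0)
    (hq.comp_continuousOn hmc) (fun s hs hsS => ?_) ?_ intervalIntegrable_const fun s hs => ?_
  · rw [intervalIntegral.integral_zero] at key
    simp only [h0, Matrix.mulVec_zero, dotProduct_zero, sub_zero] at key
    by_contra hne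
    have := hPp.dotProduct_mulVec_pos hne
    simp only [star_trivial] at this
    linarith
  · refine HasDerivAt.dotProduct_mulVec_self hP ?_
    refine (HasDerivAt.fun_sum fun k _ => he.hasDerivAt hS ht₀ hs.1 hsS k).congr_deriv ?_
    rw [Finset.sum_add_distrib, ← Matrix.mulVec_sum, ← Matrix.mulVec_sum,
      sum_diffusiveCoupling (hbal s (ht₀.trans hs.1.le)), Matrix.mulVec_zero, add_zero]
  · exact (hq'.comp_continuousOn hmc).intervalIntegrable_of_Icc ht
  · have := hPu (∑ k, e s k) 0
    simpa using this

theorem IsClosedLoopSolution.storage_le {t₀ : ℝ} {e : ℝ → Fin N → Fin n → ℝ}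
    (he : IsClosedLoopSolution A B C G t₀ e) (hS : G.BreakpointsIn S) (ht₀ : 0 ≤ t₀)
    (hP : P.IsSymm) (hPu : ∀ v u, 2 * (v ⬝ᵥ (P *ᵥ (A *ᵥ v + B *ᵥ u))) ≤ 2 * ((C *ᵥ v) ⬝ᵥ u))
    (hbal : ∀ t, 0 ≤ t → G.Balanced t) {a b : ℝ} (ha : t₀ ≤ a) (hab : a ≤ b) :
    storage P (e b) ≤ storage P (e a) := by
  have h1 := he.storage_sub_le hS ht₀ hP hPu hbal ha hab
  have h2 := intervalIntegral_neg_disagreement_nonpos (G := G) (ht₀.trans ha) hab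
    (fun t k => C *ᵥ e t k)
  linarith

theorem UniformlyExciting.exists_contraction (hEx : UniformlyExciting A C G)
    (hS : G.BreakpointsIn S) (hPp : P.PosDef) (hP : P.IsSymm)
    (hPu : ∀ v u, 2 * (v ⬝ᵥ (P *ᵥ (A *ᵥ v + B *ᵥ u))) ≤ 2 * ((C *ᵥ v) ⬝ᵥ u))
    (hbal : ∀ t, 0 ≤ t → G.Balanced t) :
    ∃ T > 0, ∃ ρ > 0, ρ < 1 ∧ ∀ t₀, 0 ≤ t₀ → ∀ e, IsClosedLoopSolution A B C G t₀ e →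
      ∑ k, e t₀ k = 0 → ∀ a, t₀ ≤ a → 0 < a → storage P (e (a + T)) ≤ ρ * storage P (e a) := by
  obtain ⟨T, hT, c, hc, hex⟩ := hEx
  obtain ⟨K, hK, hW⟩ := exists_storage_sub_free_le (G := G) hS hPp hP hPu hbal T
  obtain ⟨K₂, hK₂, hD⟩ := exists_le_mul_of_homogeneous (X := Fin N → Fin n → ℝ)
    (f := fun r => disagreement (Matrix.of fun _ _ => G.γ) (fun k => C *ᵥ r k)) (g := storage P)
    (by simp only [disagreement, dotProduct, Matrix.mulVec, Pi.sub_apply]; fun_prop)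
    (continuous_storage P)
    (fun s x => by
      rw [← disagreement_smul]
      simp only [Pi.smul_apply, Matrix.mulVec_smul]
      rfl)
    (storage_smul P) (fun x hx => storage_pos hPp hx)
  obtain ⟨K₃, hK₃, hV⟩ := exists_le_mul_of_homogeneous (X := Fin N → Fin n → ℝ)
    (f := storage P) (g := storage 1) (continuous_storage P) (continuous_storage 1)
    (storage_smul P) (storage_smul 1) (fun x hx => storage_pos Matrix.PosDef.one hx)
  -- Over one window the free motion's disagreement integrates to at most `Q` times the loss of
  -- storage: `2` comes from the trajectory itself, `2 T K₂ K` from its deviation from free motion.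
  set Q : ℝ := 2 + 2 * T * (K₂ * K) with hQ
  have hQ0 : 0 < Q := by positivity
  -- The `max` with `1 / 2` keeps the factor positive, so that its logarithm can serve as a rate.
  refine ⟨T, hT, max (1 - c / (K₃ * Q)) (1 / 2), by positivity, ?_,
    fun t₀ ht₀ e he h0 a ha ha0 => ?_⟩
  · refine max_lt ?_ (by norm_num)
    have : 0 < c / (K₃ * Q) := by positivity
    linarith
  have hab : a ≤ a + T := by linarith
  have hec : ContinuousOn e (Icc a (a + T)) := he.1.mono fun t ht => ha.trans ht.1
  set z : ℝ → Fin N → Fin n → ℝ := fun t k => NormedSpace.exp ((t - a) • A) *ᵥ e a k with hz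
  have hzc : Continuous z := continuous_pi fun k => A.continuous_exp_smul_mulVec (e a k) a
  set ΔV := storage P (e a) - storage P (e (a + T)) with hΔ
  have hpt : ∀ t ∈ Icc a (a + T), disagreement (G.adj t) (fun k => C *ᵥ z t k) ≤
      (-2) * (-disagreement (G.adj t) (fun k => C *ᵥ e t k)) + 2 * (K₂ * K) * ΔV := fun t ht => by
    have ht0 := ha0.le.trans ht.1
    have h1 := disagreement_add_le (G.adj_nonneg ht0) (fun k => C *ᵥ e t k)
      (fun k => C *ᵥ (z t k - e t k))
    have h2 : (fun k => C *ᵥ e t k) + (fun k => C *ᵥ (z t k - e t k)) = fun k => C *ᵥ z t k := by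
      funext k
      simp only [Pi.add_apply, ← Matrix.mulVec_add, add_sub_cancel]
    have h3 := (disagreement_le (G.adj_le ht0) (fun k => C *ᵥ (z t k - e t k))).trans
      (hD fun k => z t k - e t k)
    have h4 := hW t₀ ht₀ e he a t ha ht.1 ht.2
    have h5 := he.storage_le hS ht₀ hP hPu hbal (ha.trans ht.1) ht.2
    have h6 : K * (storage P (e a) - storage P (e t)) ≤ K * ΔV :=
      mul_le_mul_of_nonneg_left (by linarith) hK
    have h7 := mul_le_mul_of_nonneg_left (h4.trans h6) hK₂.le
    rw [h2] at h1
    linarith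
  have hint : IntervalIntegrable (fun t => -disagreement (G.adj t) (fun k => C *ᵥ e t k))
      MeasureTheory.volume a (a + T) := by
    refine hS.intervalIntegrable ha0.le hab hec
      (Ψ := fun q => -disagreement q.1 (fun j => C *ᵥ q.2 j)) ?_
    simp only [disagreement, dotProduct]
    fun_prop
  have hintz : IntervalIntegrable (fun t => disagreement (G.adj t) (fun k => C *ᵥ z t k))
      MeasureTheory.volume a (a + T) := by
    refine hS.intervalIntegrable ha0.le hab hzc.continuousOn
      (Ψ := fun q => disagreement q.1 (fun j => C *ᵥ q.2 j)) ?_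
    simp only [disagreement, dotProduct]
    fun_prop
  have h1 := hex a ha0 (e a) (he.sum_eq_zero hS ht₀ hPp hP hPu hbal h0 ha)
  have h2 := intervalIntegral.integral_mono_on hab hintz
    ((hint.const_mul (-2)).add intervalIntegrable_const) hpt
  rw [intervalIntegral.integral_add (hint.const_mul (-2)) intervalIntegrable_const,
    intervalIntegral.integral_const_mul, intervalIntegral.integral_const, add_sub_cancel_left,
    smul_eq_mul] at h2
  have h3 := he.storage_sub_le hS ht₀ hP hPu hbal ha hab
  have h4 : c * ∑ k, e a k ⬝ᵥ e a k ≤ Q * ΔV := by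
    rw [hQ]
    linarith
  have h5 : storage P (e a) ≤ K₃ * ∑ k, e a k ⬝ᵥ e a k := by
    simpa [storage] using hV (e a)
  have hmain : c / (K₃ * Q) * storage P (e a) ≤ ΔV := by
    rw [div_mul_eq_mul_div, div_le_iff₀ (by positivity)]
    have := mul_le_mul_of_nonneg_left h5 hc.le
    have := mul_le_mul_of_nonneg_left h4 hK₃.le
    linarith
  have h6 := mul_le_mul_of_nonneg_right (le_max_left (1 - c / (K₃ * Q)) (1 / 2))
    (storage_nonneg hPp (e a))
  linarith

/-- A passive network with balanced coupling and uniformly exciting graph synchronizes. -/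
theorem UniformlyExciting.exponentiallySynchronizes (hEx : UniformlyExciting A C G)
    (hS : G.BreakpointsIn S) (hAB : IsPassive A B C) (hbal : ∀ t, 0 ≤ t → G.Balanced t) :
    ExponentiallySynchronizes A B C G := by
  obtain ⟨P, hPp, hP, hPu⟩ := hAB.exists_storage
  obtain ⟨T, hT, ρ, hρ, hρ1, hcon⟩ := hEx.exists_contraction hS hPp hP hPu hbal
  obtain ⟨K, hK, hVle⟩ := exists_le_mul_of_homogeneous (X := Fin N → Fin n → ℝ)
    (f := storage P) (g := storage 1) (continuous_storage P) (continuous_storage 1)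
    (storage_smul P) (storage_smul 1) (fun x hx => storage_pos Matrix.PosDef.one hx)
  obtain ⟨K', hK', hleV⟩ := exists_le_mul_of_homogeneous (X := Fin N → Fin n → ℝ)
    (f := storage 1) (g := storage P) (continuous_storage 1) (continuous_storage P)
    (storage_smul 1) (storage_smul P) (fun x hx => storage_pos hPp hx)
  have hstack : ∀ z : Fin N → Fin n → ℝ, stackNorm z = √(storage 1 z) := fun z => by
    simp [stackNorm, storage, dotProduct, sq]
  have hlog : Real.log ρ < 0 := Real.log_neg hρ hρ1
  set δ : ℝ := -Real.log ρ / T with hδ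
  have hδ0 : 0 < δ := div_pos (neg_pos.mpr hlog) hT
  -- `K' K` compares `V` with the Euclidean norm; in the exponent, `1` pays for the initial delay
  -- and `T` for the incomplete last window. The square roots of `R` and of the decay factor appear
  -- because `V` is quadratic.
  set R : ℝ := K' * K * Real.exp (δ * (1 + T)) with hR
  have hR0 : 0 < R := by positivity
  refine ⟨√R, Real.sqrt_pos.mpr hR0, δ / 2, by positivity, fun t₀ ht₀ x hx => ?_⟩
  set v : Fin n → ℝ := (1 / (N : ℝ)) • ∑ k, x t₀ k with hv
  set x₀ : ℝ → Fin n → ℝ := fun t => NormedSpace.exp ((t - t₀) • A) *ᵥ v with hx₀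
  have hd : ∀ t, HasDerivAt x₀ (A *ᵥ x₀ t) t := fun t => A.hasDerivAt_exp_smul_mulVec v t₀ t
  refine ⟨x₀, hd, fun t ht => ?_⟩
  have he := hx.sub_free hd
  set e : ℝ → Fin N → Fin n → ℝ := fun t k => x t k - x₀ t with he_def
  have h0 : ∑ k, e t₀ k = 0 := by
    have h00 : x₀ t₀ = v := by simp [hx₀]
    simp only [he_def, Finset.sum_sub_distrib, h00, Finset.sum_const, Finset.card_univ,
      Fintype.card_fin, hv]
    rcases Nat.eq_zero_or_pos N with hN | hN
    · subst hN; simp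
    · have : (N : ℝ) ≠ 0 := by positivity
      rw [← Nat.cast_smul_eq_nsmul ℝ, smul_smul, mul_one_div_cancel this, one_smul, sub_self]
  -- The windows start at `t₀ + 1` because contraction is available only from positive times, while
  -- `t₀` may be zero.
  have hiter : ∀ m : ℕ, storage P (e (t₀ + 1 + m * T)) ≤ ρ ^ m * storage P (e t₀) := fun m => by
    induction m with
    | zero =>
      simpa using he.storage_le hS ht₀ hP hPu hbal le_rfl (b := t₀ + 1) (by linarith)
    | succ m ih =>
      have hmT : 0 ≤ (m : ℝ) * T := by positivity
      have h1 := hcon t₀ ht₀ e he h0 (t₀ + 1 + m * T) (by linarith) (by linarith)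
      have h2 : t₀ + 1 + ((m + 1 : ℕ) : ℝ) * T = t₀ + 1 + m * T + T := by push_cast; ring
      rw [h2]
      refine h1.trans ?_
      have h3 := mul_le_mul_of_nonneg_left ih hρ.le
      rw [pow_succ]
      linarith
  have hdecay : storage P (e t) ≤
      Real.exp (δ * (1 + T)) * Real.exp (-δ * (t - t₀)) * storage P (e t₀) := by
    set m : ℕ := ⌊(t - (t₀ + 1)) / T⌋₊ with hm
    have h1 : (t - (t₀ + 1)) / T < m + 1 := Nat.lt_floor_add_one _
    have h2 : storage P (e t) ≤ ρ ^ m * storage P (e t₀) := by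
      rcases le_total (t₀ + 1) t with hle | hle
      · have h3 : (m : ℝ) ≤ (t - (t₀ + 1)) / T :=
          Nat.floor_le (div_nonneg (by linarith) hT.le)
        rw [le_div_iff₀ hT] at h3
        have hmT : 0 ≤ (m : ℝ) * T := by positivity
        exact (he.storage_le hS ht₀ hP hPu hbal (a := t₀ + 1 + m * T) (by linarith)
          (by linarith)).trans (hiter m)
      · have : m = 0 := Nat.floor_of_nonpos (div_nonpos_of_nonpos_of_nonneg (by linarith) hT.le)
        rw [this, pow_zero, one_mul]
        exact he.storage_le hS ht₀ hP hPu hbal le_rfl ht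
    refine h2.trans (mul_le_mul_of_nonneg_right ?_ (storage_nonneg hPp _))
    have h4 : ρ ^ m = Real.exp (-(δ * T * m)) := by
      rw [hδ, div_mul_cancel₀ _ hT.ne', neg_mul, neg_neg, mul_comm, Real.exp_nat_mul,
        Real.exp_log hρ]
    rw [h4, ← Real.exp_add]
    apply Real.exp_le_exp.mpr
    rw [div_lt_iff₀ hT] at h1
    have := mul_le_mul_of_nonneg_left h1.le hδ0.le
    linarith
  have hfin : storage 1 (e t) ≤ R * Real.exp (-δ * (t - t₀)) * storage 1 (e t₀) := by
    have h1 := hleV (e t)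
    have h2 := mul_le_mul_of_nonneg_left hdecay hK'.le
    have h3 := mul_le_mul_of_nonneg_left (hVle (e t₀))
      (by positivity : 0 ≤ K' * (Real.exp (δ * (1 + T)) * Real.exp (-δ * (t - t₀))))
    rw [hR]
    linarith
  rw [hstack, hstack]
  refine (Real.sqrt_le_sqrt hfin).trans_eq ?_
  rw [Real.sqrt_mul (by positivity), Real.sqrt_mul hR0.le]
  congr 2
  rw [Real.sqrt_eq_iff_mul_self_eq (by positivity) (by positivity), ← Real.exp_add]
  congr 1
  ring

end

/-! ### Excitation from connectedness and observability. -/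

section
variable {n p N : ℕ} {A : Matrix (Fin n) (Fin n) ℝ} {C : Matrix (Fin p) (Fin n) ℝ}
  {G : CommGraph N} {S : Set ℝ}

theorem Relation.ReflTransGen.exists_dotProduct_sub_le {R : Fin N → Fin N → Prop} {j k : Fin N}
    (h : Relation.ReflTransGen R j k) : ∃ K : ℝ, ∀ (y : Fin N → Fin p → ℝ) (s : ℝ),
      (∀ u v, R u v → (y v - y u) ⬝ᵥ (y v - y u) ≤ s) → (y k - y j) ⬝ᵥ (y k - y j) ≤ K * s := by
  induction h with
  | refl => exact ⟨0, fun y s _ => by simp⟩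
  | @tail b c _ hbc ih =>
    obtain ⟨K, hK⟩ := ih
    refine ⟨2 * K + 2, fun y s hs => ?_⟩
    have h1 := dotProduct_add_self_le (y b - y j) (y c - y b)
    have e : y b - y j + (y c - y b) = y c - y j := by abel
    rw [e] at h1
    have h2 := hK y s hs
    have h3 := hs b c hbc
    linarith

/-- There are only finitely many relations on `Fin N`, so the path constants have a common bound.
This is what makes the estimate independent of the time-varying graph. -/
theorem exists_uniform_dotProduct_sub_le (N p : ℕ) : ∃ K ≥ 0, ∀ (R : Fin N → Fin N → Prop)
    (j k : Fin N), Relation.ReflTransGen R j k → ∀ (y : Fin N → Fin p → ℝ) (s : ℝ), 0 ≤ s →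
      (∀ u v, R u v → (y v - y u) ⬝ᵥ (y v - y u) ≤ s) → (y k - y j) ⬝ᵥ (y k - y j) ≤ K * s := by
  have h : ∀ q : (Fin N → Fin N → Prop) × Fin N × Fin N, ∃ K : ℝ,
      Relation.ReflTransGen q.1 q.2.1 q.2.2 → ∀ (y : Fin N → Fin p → ℝ) (s : ℝ),
        (∀ u v, q.1 u v → (y v - y u) ⬝ᵥ (y v - y u) ≤ s) →
          (y q.2.2 - y q.2.1) ⬝ᵥ (y q.2.2 - y q.2.1) ≤ K * s := fun q => by
    by_cases hq : Relation.ReflTransGen q.1 q.2.1 q.2.2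
    · obtain ⟨K, hK⟩ := hq.exists_dotProduct_sub_le (p := p)
      exact ⟨K, fun _ => hK⟩
    · exact ⟨0, fun h => absurd h hq⟩
  choose f hf using h
  obtain ⟨K, hK⟩ := (Set.finite_range f).bddAbove
  refine ⟨max K 0, le_max_right _ _, fun R j k hjk y s hs hR => ?_⟩
  refine (hf (R, j, k) hjk y s hR).trans (mul_le_mul_of_nonneg_right ?_ hs)
  exact (hK ⟨_, rfl⟩).trans (le_max_left _ _)

/-- The mean minimizes the sum of squared distances. Taking `w` to be the value at a root reduces
the Poincaré inequality to paths into that root. -/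
theorem sum_dotProduct_self_le_of_sum_eq_zero {y : Fin N → Fin p → ℝ} (hy : ∑ k, y k = 0)
    (w : Fin p → ℝ) : ∑ k, y k ⬝ᵥ y k ≤ ∑ k, (w - y k) ⬝ᵥ (w - y k) := by
  have h1 : ∑ k, (w - y k) ⬝ᵥ (w - y k) =
      ∑ k, y k ⬝ᵥ y k + ∑ _k : Fin N, w ⬝ᵥ w - 2 * (w ⬝ᵥ ∑ k, y k) := by
    rw [dotProduct_sum, Finset.mul_sum, ← Finset.sum_add_distrib, ← Finset.sum_sub_distrib]
    refine Finset.sum_congr rfl fun k _ => ?_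
    rw [sub_dotProduct, dotProduct_sub, dotProduct_sub, dotProduct_comm (y k) w]
    ring
  rw [h1, hy, dotProduct_zero]
  have : 0 ≤ ∑ _k : Fin N, w ⬝ᵥ w := Finset.sum_nonneg fun _ _ => dotProduct_self_nonneg' w
  linarith

/-- Connected graphs satisfy a Poincaré inequality with a constant independent of the graph. -/
theorem CommGraph.exists_sum_dotProduct_self_le_disagreement (G : CommGraph N) (p : ℕ) :
    ∃ K > 0, ∀ t, 0 ≤ t → G.Connected t → ∀ y : Fin N → Fin p → ℝ, ∑ k, y k = 0 →
      ∑ k, y k ⬝ᵥ y k ≤ K * disagreement (G.adj t) y := by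
  obtain ⟨K, hK, h⟩ := exists_uniform_dotProduct_sub_le N p
  have hη := G.η_pos
  -- The summand `1` only secures positivity, as `N` or `K` may vanish.
  refine ⟨N * K / G.η + 1, by positivity, fun t ht hcon y hy => ?_⟩
  obtain ⟨r, hr⟩ := hcon
  have hD := disagreement_nonneg (G.adj_nonneg ht) y
  have hedge : ∀ u v, G.Neighbor t u v →
      (y v - y u) ⬝ᵥ (y v - y u) ≤ disagreement (G.adj t) y / G.η := fun u v huv => by
    rw [le_div_iff₀ hη, mul_comm]
    refine (mul_le_mul_of_nonneg_right (huv : G.η ≤ G.adj t u v)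
      (dotProduct_self_nonneg' _)).trans ?_
    have hterm : ∀ k j, 0 ≤ G.adj t k j * ((y j - y k) ⬝ᵥ (y j - y k)) := fun k j =>
      mul_nonneg (G.adj_nonneg ht k j) (dotProduct_self_nonneg' _)
    exact (Finset.single_le_sum (fun j _ => hterm u j) (Finset.mem_univ v)).trans
      (Finset.single_le_sum (f := fun k => ∑ j, G.adj t k j * ((y j - y k) ⬝ᵥ (y j - y k)))
        (fun k _ => Finset.sum_nonneg fun j _ => hterm k j) (Finset.mem_univ u))
  refine (sum_dotProduct_self_le_of_sum_eq_zero hy (y r)).trans ?_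
  refine (Finset.sum_le_sum fun k _ => h _ k r (hr k) y _ (div_nonneg hD hη.le) hedge).trans ?_
  rw [Finset.sum_const, Finset.card_univ, Fintype.card_fin, nsmul_eq_mul]
  have : (N : ℝ) * (K * (disagreement (G.adj t) y / G.η)) =
      N * K / G.η * disagreement (G.adj t) y := by ring
  rw [this]
  linarith

theorem Matrix.analyticOnNhd_mulVec_exp_smul_mulVec (A : Matrix (Fin n) (Fin n) ℝ)
    (C : Matrix (Fin p) (Fin n) ℝ) (v : Fin n → ℝ) :
    AnalyticOnNhd ℝ (fun t : ℝ => C *ᵥ (NormedSpace.exp (t • A) *ᵥ v)) univ := by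
  open scoped Matrix.Norms.Operator in
  intro t _
  have h1 : AnalyticAt ℝ (fun t : ℝ => NormedSpace.exp (t • A)) t :=
    (NormedSpace.exp_analytic (𝕂 := ℝ) (t • A)).comp (f := fun t : ℝ => t • A)
      (analyticAt_id.smul analyticAt_const)
  have h2 : AnalyticAt ℝ ((Matrix.mulVecBilin ℝ ℝ).flip v).toContinuousLinearMap
    (NormedSpace.exp (t • A)) := ContinuousLinearMap.analyticAt _ _
  have h3 : AnalyticAt ℝ (Matrix.mulVecLin C).toContinuousLinearMap
    (NormedSpace.exp (t • A) *ᵥ v) := ContinuousLinearMap.analyticAt _ _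
  exact AnalyticAt.comp (f := fun t : ℝ => NormedSpace.exp (t • A) *ᵥ v) h3
    (AnalyticAt.comp (f := fun t : ℝ => NormedSpace.exp (t • A)) h2 h1)

/-- The output energy over a unit window is a positive definite quadratic form, so compactness gives
the constant; time invariance makes it independent of `a`. -/
theorem IsObservable.exists_dotProduct_self_le (h : IsObservable A C) :
    ∃ K > 0, ∀ (a : ℝ) (v : Fin n → ℝ), v ⬝ᵥ v ≤ K * ∫ t in a..(a + 1),
      (C *ᵥ (NormedSpace.exp ((t - a) • A) *ᵥ v)) ⬝ᵥ
        (C *ᵥ (NormedSpace.exp ((t - a) • A) *ᵥ v)) := by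
  have hexp : Continuous fun t : ℝ => NormedSpace.exp (t • A) := by
    open scoped Matrix.Norms.Operator in
    exact NormedSpace.exp_continuous.comp (continuous_id.smul continuous_const)
  have hcont : Continuous (Function.uncurry fun (v : Fin n → ℝ) (t : ℝ) =>
      (C *ᵥ (NormedSpace.exp (t • A) *ᵥ v)) ⬝ᵥ (C *ᵥ (NormedSpace.exp (t • A) *ᵥ v))) := by
    have h1 : Continuous fun q : (Fin n → ℝ) × ℝ => C *ᵥ (NormedSpace.exp (q.2 • A) *ᵥ q.1) :=
      continuous_const.matrix_mulVec ((hexp.comp continuous_snd).matrix_mulVec continuous_fst)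
    exact h1.dotProduct h1
  obtain ⟨K, hK, hle⟩ := exists_le_mul_of_homogeneous (X := Fin n → ℝ) (f := fun v => v ⬝ᵥ v)
    (g := fun v => ∫ t in (0 : ℝ)..1,
      (C *ᵥ (NormedSpace.exp (t • A) *ᵥ v)) ⬝ᵥ (C *ᵥ (NormedSpace.exp (t • A) *ᵥ v)))
    (continuous_id.dotProduct continuous_id)
    (intervalIntegral.continuous_parametric_intervalIntegral_of_continuous' hcont 0 1)
    (fun c x => by simp only [smul_dotProduct, dotProduct_smul, smul_eq_mul]; ring)
    (fun c x => by
      rw [← intervalIntegral.integral_const_mul]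
      refine intervalIntegral.integral_congr fun t _ => ?_
      simp only [Matrix.mulVec_smul, smul_dotProduct, dotProduct_smul, smul_eq_mul]
      ring)
    (fun v hv => by
      refine intervalIntegral.integral_pos one_pos
        (hcont.comp (Continuous.prodMk_right v)).continuousOn
        (fun _ _ => dotProduct_self_nonneg' _) ?_
      by_contra! hle
      have hz : ∀ t ∈ Icc (0 : ℝ) 1, C *ᵥ (NormedSpace.exp (t • A) *ᵥ v) = 0 := fun t ht =>
        dotProduct_self_eq_zero.mp (le_antisymm (hle t ht) (dotProduct_self_nonneg' _))
      -- The output is analytic in time, so vanishing near `1 / 2` forces it to vanish at all times,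
      -- where observability applies.
      have hev : (fun t : ℝ => C *ᵥ (NormedSpace.exp (t • A) *ᵥ v)) =ᶠ[𝓝 (1 / 2)] 0 := by
        filter_upwards [Icc_mem_nhds (by norm_num : (0 : ℝ) < 1 / 2)
          (by norm_num : (1 / 2 : ℝ) < 1)] with t ht
        exact hz t ht
      have heq := (A.analyticOnNhd_mulVec_exp_smul_mulVec C v).eq_of_eventuallyEq
        analyticOnNhd_const hev
      exact hv (h v fun t _ => congrFun heq t))
  refine ⟨K, hK, fun a v => (hle v).trans_eq ?_⟩
  rw [intervalIntegral.integral_comp_sub_right (fun t =>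
    (C *ᵥ (NormedSpace.exp (t • A) *ᵥ v)) ⬝ᵥ (C *ᵥ (NormedSpace.exp (t • A) *ᵥ v))) a,
    sub_self, add_sub_cancel_left]

/-- Observability is used agent by agent; the Poincaré inequality then acts at each instant, since
free motions preserve zero mean. -/
theorem UniformlyExciting.of_connected (hS : G.BreakpointsIn S) (hobs : IsObservable A C)
    (hcon : ∀ t, 0 ≤ t → G.Connected t) : UniformlyExciting A C G := by
  obtain ⟨K, hK, hG⟩ := G.exists_sum_dotProduct_self_le_disagreement p
  obtain ⟨K', hK', hO⟩ := hobs.exists_dotProduct_self_le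
  refine ⟨1, one_pos, (K' * K)⁻¹, by positivity, fun a ha v hv => ?_⟩
  have hyc : ∀ k, Continuous fun t => C *ᵥ (NormedSpace.exp ((t - a) • A) *ᵥ v k) := fun k =>
    continuous_const.matrix_mulVec (A.continuous_exp_smul_mulVec (v k) a)
  have hab : a ≤ a + 1 := by linarith
  rw [inv_mul_le_iff₀ (by positivity), mul_assoc, ← intervalIntegral.integral_const_mul]
  calc ∑ k, v k ⬝ᵥ v k
      ≤ ∑ k, K' * ∫ t in a..(a + 1), (C *ᵥ (NormedSpace.exp ((t - a) • A) *ᵥ v k)) ⬝ᵥ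
          (C *ᵥ (NormedSpace.exp ((t - a) • A) *ᵥ v k)) :=
        Finset.sum_le_sum fun k _ => hO a (v k)
    _ = K' * ∫ t in a..(a + 1), ∑ k, (C *ᵥ (NormedSpace.exp ((t - a) • A) *ᵥ v k)) ⬝ᵥ
          (C *ᵥ (NormedSpace.exp ((t - a) • A) *ᵥ v k)) := by
        rw [← Finset.mul_sum, intervalIntegral.integral_finsetSum fun k _ =>
          ((hyc k).dotProduct (hyc k)).intervalIntegrable _ _]
    _ ≤ _ := by
        refine mul_le_mul_of_nonneg_left (intervalIntegral.integral_mono_on hab ?_ ?_ ?_) hK'.le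
        · exact (continuous_finsetSum _ fun k _ =>
            (hyc k).dotProduct (hyc k)).intervalIntegrable _ _
        · refine IntervalIntegrable.const_mul ?_ K
          exact hS.intervalIntegrable ha.le hab (continuous_pi hyc).continuousOn
            continuous_disagreement
        · intro t ht
          have ht0 := ha.le.trans ht.1
          refine hG t ht0 (hcon t ht0) _ ?_
          rw [← Matrix.mulVec_sum, ← Matrix.mulVec_sum, hv, Matrix.mulVec_zero,
            Matrix.mulVec_zero]

end

/-! ### Excitation from the observability Gramian. -/

section
variable {n p N : ℕ}

/-- `M ↦ 1 ⊗ₖ M` is a continuous ring homomorphism, hence commutes with the exponential. -/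
theorem Matrix.exp_one_kronecker (A : Matrix (Fin n) (Fin n) ℝ) :
    NormedSpace.exp ((1 : Matrix (Fin N) (Fin N) ℝ) ⊗ₖ A) = 1 ⊗ₖ NormedSpace.exp A := by
  open scoped Matrix.Norms.Operator in
  let f : Matrix (Fin n) (Fin n) ℝ →+* Matrix (Fin N × Fin n) (Fin N × Fin n) ℝ :=
    { toFun := fun M => 1 ⊗ₖ M
      map_one' := Matrix.one_kronecker_one
      map_mul' := fun M M' => by rw [← Matrix.mul_kronecker_mul, one_mul]
      map_zero' := Matrix.kronecker_zero _
      map_add' := fun M M' => Matrix.kronecker_add _ _ _ }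
  have hf : Continuous f := by
    refine continuous_matrix fun i j => ?_
    exact continuous_const.mul (continuous_id.matrix_elem _ _)
  exact (NormedSpace.map_exp f hf A).symm

theorem Matrix.one_kronecker_mulVec (C : Matrix (Fin p) (Fin n) ℝ) (z : Fin N → Fin n → ℝ) :
    ((1 : Matrix (Fin N) (Fin N) ℝ) ⊗ₖ C) *ᵥ Function.uncurry z =
      Function.uncurry fun k => C *ᵥ z k := by
  ext ⟨k, i⟩
  simp only [Matrix.mulVec, dotProduct, Fintype.sum_prod_type, Matrix.kroneckerMap_apply,
    Matrix.one_apply, ite_mul, one_mul, zero_mul, Function.uncurry_apply_pair]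
  rw [Finset.sum_comm]
  simp

theorem Matrix.kronecker_one_mulVec {M : Matrix (Fin N) (Fin N) ℝ} (y : Fin N → Fin p → ℝ) :
    (M ⊗ₖ (1 : Matrix (Fin p) (Fin p) ℝ)) *ᵥ Function.uncurry y =
      Function.uncurry fun k => ∑ j, M k j • y j := by
  ext ⟨k, i⟩
  simp [Matrix.mulVec, dotProduct, Fintype.sum_prod_type, Matrix.one_apply]

theorem uncurry_dotProduct_uncurry (y z : Fin N → Fin p → ℝ) :
    Function.uncurry y ⬝ᵥ Function.uncurry z = ∑ k, y k ⬝ᵥ z k := by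
  simp [dotProduct, Fintype.sum_prod_type]

theorem disagreementProj_kronecker_one_mulVec {v : Fin N → Fin n → ℝ} (hv : ∑ k, v k = 0) :
    (disagreementProj N ⊗ₖ (1 : Matrix (Fin n) (Fin n) ℝ)) *ᵥ Function.uncurry v =
      Function.uncurry v := by
  rw [Matrix.kronecker_one_mulVec]
  congr 1
  funext k
  simp only [disagreementProj, Matrix.sub_apply, Matrix.smul_apply, Matrix.of_apply, sub_smul,
    Finset.sum_sub_distrib, smul_eq_mul, mul_one, ← Finset.smul_sum, hv, smul_zero, sub_zero]
  simp [Matrix.one_apply]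

variable {A : Matrix (Fin n) (Fin n) ℝ} {C : Matrix (Fin p) (Fin n) ℝ}
  {G : CommGraph N} {S : Set ℝ}

theorem CommGraph.sum_laplacian_smul {t : ℝ} (ht : 0 ≤ t) (y : Fin N → Fin p → ℝ) (k : Fin N) :
    ∑ j, G.laplacian t k j • y j = -diffusiveCoupling (G.adj t) y k := by
  have h : ∀ j, G.laplacian t k j = (if j = k then ∑ i, G.adj t k i else 0) - G.adj t k j := by
    intro j
    by_cases hjk : j = k
    · subst hjk
      simp [laplacian, G.no_loops t ht]
    · simp [laplacian, hjk]
  simp only [h, sub_smul, Finset.sum_sub_distrib, ite_smul, zero_smul, Finset.sum_ite_eq',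
    Finset.mem_univ, if_true, diffusiveCoupling, smul_sub, ← Finset.sum_smul, neg_sub]

theorem CommGraph.balanced_of_symmetric {t : ℝ} (h : G.Symmetric t) : G.Balanced t := fun k =>
  Finset.sum_congr rfl fun j _ => h.apply j k

theorem CommGraph.exists_continuous_laplacian (G : CommGraph N) :
    ∃ F : Matrix (Fin N) (Fin N) ℝ → Matrix (Fin N) (Fin N) ℝ, Continuous F ∧
      ∀ t, G.laplacian t = F (G.adj t) := by
  refine ⟨fun M => Matrix.of fun k j => if j = k then ∑ i, M k i else -M k j, ?_, fun t => rfl⟩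
  refine continuous_matrix fun k j => ?_
  by_cases h : j = k
  · simp only [Matrix.of_apply, h, if_true]; fun_prop
  · simp only [Matrix.of_apply, h, if_false]; fun_prop

/-- The Gramian bound makes the graph exciting for every real level `α > 0`. -/
theorem UniformlyExciting.of_obsGramian (hS : G.BreakpointsIn S)
    (hbal : ∀ t, 0 ≤ t → G.Balanced t) {M : ℕ} {D : ℝ → Matrix (Fin N) (Fin M) ℝ}
    (hD : ∀ t, 0 ≤ t → G.laplacian t = D t * (D t)ᵀ) {T α : ℝ} (hT : 0 < T) (hα : 0 < α)
    (hgram : ∀ t₀ : ℝ, 0 < t₀ →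
      (obsGramian ((1 : Matrix (Fin N) (Fin N) ℝ) ⊗ₖ A)
        (fun t => (D t ⊗ₖ (1 : Matrix (Fin p) (Fin p) ℝ))ᵀ *
          ((1 : Matrix (Fin N) (Fin N) ℝ) ⊗ₖ C)) t₀ T -
        α • (disagreementProj N ⊗ₖ (1 : Matrix (Fin n) (Fin n) ℝ))).PosSemidef) :
    UniformlyExciting A C G := by
  refine ⟨T, hT, 2 * α, by positivity, fun a ha v hv => ?_⟩
  have hab : a ≤ a + T := by linarith
  set R : ℝ → Matrix (Fin M × Fin p) (Fin N × Fin n) ℝ := fun t =>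
    (D t ⊗ₖ (1 : Matrix (Fin p) (Fin p) ℝ))ᵀ * ((1 : Matrix (Fin N) (Fin N) ℝ) ⊗ₖ C) *
      NormedSpace.exp ((t - a) • ((1 : Matrix (Fin N) (Fin N) ℝ) ⊗ₖ A)) with hR
  have hexp : ∀ t, NormedSpace.exp ((t - a) • ((1 : Matrix (Fin N) (Fin N) ℝ) ⊗ₖ A)) =
      1 ⊗ₖ NormedSpace.exp ((t - a) • A) := fun t => by
    rw [← Matrix.kronecker_smul, Matrix.exp_one_kronecker]
  have hDD : ∀ t, 0 ≤ t → (D t ⊗ₖ (1 : Matrix (Fin p) (Fin p) ℝ)) *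
      (D t ⊗ₖ (1 : Matrix (Fin p) (Fin p) ℝ))ᵀ = G.laplacian t ⊗ₖ 1 := fun t ht => by
    rw [← Matrix.kroneckerMap_transpose, ← Matrix.mul_kronecker_mul, ← hD t ht,
      Matrix.transpose_one, one_mul]
  -- With `y` the stacked free outputs, `|R v|² = yᵀ (L ⊗ I) y = -∑ k, y_k ⬝ᵥ u_k`, which is half
  -- the disagreement.
  have hRR : ∀ t, 0 ≤ t → 2 * ((R t *ᵥ Function.uncurry v) ⬝ᵥ (R t *ᵥ Function.uncurry v)) =
      disagreement (G.adj t) (fun k => C *ᵥ (NormedSpace.exp ((t - a) • A) *ᵥ v k)) :=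
    fun t ht => by
    rw [hR]
    simp only
    rw [hexp, Matrix.mul_assoc, ← Matrix.mulVec_mulVec, ← Matrix.mulVec_mulVec,
      Matrix.one_kronecker_mulVec, Matrix.one_kronecker_mulVec, Matrix.dotProduct_mulVec,
      ← Matrix.mulVec_transpose, Matrix.transpose_transpose, Matrix.mulVec_mulVec, hDD t ht,
      Matrix.kronecker_one_mulVec, dotProduct_comm, uncurry_dotProduct_uncurry]
    simp only [CommGraph.sum_laplacian_smul ht, dotProduct_neg, Finset.sum_neg_distrib, mul_neg]
    rw [two_mul_sum_dotProduct_diffusiveCoupling (hbal t ht), neg_neg]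
  -- No regularity of `D` is assumed, but the integrand involves only `D Dᵀ = L`, a continuous
  -- function of the weights.
  have hint : ∀ i j, IntervalIntegrable (fun t => ((R t)ᵀ * R t) i j) MeasureTheory.volume
      a (a + T) := fun i j => by
    obtain ⟨F, hF, hFL⟩ := G.exists_continuous_laplacian
    have hcexp : Continuous fun t : ℝ => NormedSpace.exp
        ((t - a) • ((1 : Matrix (Fin N) (Fin N) ℝ) ⊗ₖ A)) := by
      open scoped Matrix.Norms.Operator in
      exact NormedSpace.exp_continuous.comp
        ((continuous_id.sub continuous_const).smul continuous_const)
    refine (hS.intervalIntegrable ha.le hab hcexp.continuousOn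
      (Ψ := fun q => ((((1 : Matrix (Fin N) (Fin N) ℝ) ⊗ₖ C) * q.2)ᵀ *
        ((F q.1 ⊗ₖ (1 : Matrix (Fin p) (Fin p) ℝ)) *
          (((1 : Matrix (Fin N) (Fin N) ℝ) ⊗ₖ C) * q.2))) i j) ?_).congr_ae ?_
    · refine Continuous.matrix_elem ?_ i j
      have h1 : Continuous fun q : Matrix (Fin N) (Fin N) ℝ ×
          Matrix (Fin N × Fin n) (Fin N × Fin n) ℝ =>
          ((1 : Matrix (Fin N) (Fin N) ℝ) ⊗ₖ C) * q.2 :=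
        continuous_const.matrix_mul continuous_snd
      have h2 : Continuous fun q : Matrix (Fin N) (Fin N) ℝ ×
          Matrix (Fin N × Fin n) (Fin N × Fin n) ℝ =>
          F q.1 ⊗ₖ (1 : Matrix (Fin p) (Fin p) ℝ) :=
        continuous_matrix fun i j =>
          ((hF.comp continuous_fst).matrix_elem _ _).mul continuous_const
      exact h1.matrix_transpose.matrix_mul (h2.matrix_mul h1)
    · filter_upwards [MeasureTheory.ae_restrict_mem measurableSet_uIoc] with t ht
      rw [uIoc_of_le hab] at ht
      have ht0 : 0 ≤ t := ha.le.trans ht.1.le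
      simp only [hR]
      rw [← hFL, ← hDD t ht0]
      simp only [Matrix.transpose_mul, Matrix.transpose_transpose, Matrix.mul_assoc]
  have hquad : Function.uncurry v ⬝ᵥ (obsGramian ((1 : Matrix (Fin N) (Fin N) ℝ) ⊗ₖ A)
      (fun t => (D t ⊗ₖ (1 : Matrix (Fin p) (Fin p) ℝ))ᵀ *
        ((1 : Matrix (Fin N) (Fin N) ℝ) ⊗ₖ C)) a T *ᵥ Function.uncurry v) =
      ∫ t in a..(a + T), (R t *ᵥ Function.uncurry v) ⬝ᵥ (R t *ᵥ Function.uncurry v) := by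
    have h1 : ∀ t, (R t *ᵥ Function.uncurry v) ⬝ᵥ (R t *ᵥ Function.uncurry v) =
        ∑ i, ∑ j, Function.uncurry v i * (((R t)ᵀ * R t) i j * Function.uncurry v j) :=
      fun t => by
      rw [Matrix.dotProduct_mulVec, ← Matrix.mulVec_transpose, Matrix.mulVec_mulVec,
        dotProduct_comm]
      simp only [dotProduct, Matrix.mulVec, Finset.mul_sum]
    simp only [h1]
    rw [intervalIntegral.integral_finsetSum fun i _ => by
      simpa only [Finset.sum_fn] using IntervalIntegrable.sum _ fun j _ =>
        ((hint i j).mul_const _).const_mul _]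
    simp only [dotProduct, Matrix.mulVec, Finset.mul_sum]
    refine Finset.sum_congr rfl fun i _ => ?_
    rw [intervalIntegral.integral_finsetSum fun j _ => ((hint i j).mul_const _).const_mul _]
    refine Finset.sum_congr rfl fun j _ => ?_
    rw [intervalIntegral.integral_const_mul, intervalIntegral.integral_mul_const]
    rfl
  have hpos := (hgram a ha).dotProduct_mulVec_nonneg (Function.uncurry v)
  rw [star_trivial, Matrix.sub_mulVec, Matrix.smul_mulVec,
    disagreementProj_kronecker_one_mulVec hv, dotProduct_sub, dotProduct_smul,
    uncurry_dotProduct_uncurry, hquad, smul_eq_mul] at hpos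
  have hfin : ∫ t in a..(a + T),
      disagreement (G.adj t) (fun k => C *ᵥ (NormedSpace.exp ((t - a) • A) *ᵥ v k)) =
      2 * ∫ t in a..(a + T), (R t *ᵥ Function.uncurry v) ⬝ᵥ (R t *ᵥ Function.uncurry v) := by
    rw [← intervalIntegral.integral_const_mul]
    refine intervalIntegral.integral_congr fun t ht => ?_
    rw [uIcc_of_le hab] at ht
    exact (hRR t (ha.le.trans ht.1)).symm
  rw [hfin]
  linarith

end
theorem mainTheorem4 {n p N : ℕ} (A : Matrix (Fin n) (Fin n) ℝ) (B : Matrix (Fin n) (Fin p) ℝ)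
    (C : Matrix (Fin p) (Fin n) ℝ) (G : CommGraph N)
    (hL_pc : PiecewiseContinuous G.laplacian)
    (hL_bdd : ∃ b : ℝ, ∀ t, 0 ≤ t → ∀ k j, |G.laplacian t k j| ≤ b)
    (h :
      (IsPassive A B C ∧ IsObservable A C ∧
        (∀ t, 0 ≤ t → G.Connected t) ∧ (∀ t, 0 ≤ t → G.Balanced t))
      ∨
      (IsPassive A B C ∧ IsObservable A C ∧ (∀ t, 0 ≤ t → G.Symmetric t) ∧
        ∃ (M : ℕ) (D : ℝ → Matrix (Fin N) (Fin M) ℝ),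
          (∀ t, 0 ≤ t → G.laplacian t = D t * (D t)ᵀ) ∧
          UniformlyObservableMod
            ((1 : Matrix (Fin N) (Fin N) ℝ) ⊗ₖ A)
            (fun t => (D t ⊗ₖ (1 : Matrix (Fin p) (Fin p) ℝ))ᵀ *
              ((1 : Matrix (Fin N) (Fin N) ℝ) ⊗ₖ C))
            (disagreementProj N ⊗ₖ (1 : Matrix (Fin n) (Fin n) ℝ)))) :
    ExponentiallySynchronizes A B C G := by

  obtain ⟨S, hS⟩ := G.exists_breakpointsIn hL_pc
  rcases h with ⟨hP, hO, hcon, hbal⟩ | ⟨hP, -, hsym, M, D, hD, hU⟩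
  · exact (UniformlyExciting.of_connected hS hO hcon).exponentiallySynchronizes hS hP hbal
  · have hbal : ∀ t, 0 ≤ t → G.Balanced t := fun t ht => CommGraph.balanced_of_symmetric (hsym t ht)
    obtain ⟨T, hT, α, hα, hgram⟩ := hU
    -- In `UniformlyObservableMod` the level `α` has no type ascription and elaborates to a natural
    -- number. It is cast to `ℝ` here, and the two scalar actions on matrices agree.
    refine (UniformlyExciting.of_obsGramian hS hbal hD hT (Nat.cast_pos (α := ℝ).mpr hα)
      fun t₀ ht₀ => ?_).exponentiallySynchronizes hS hP hbal
    rw [Nat.cast_smul_eq_nsmul]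
    exact hgram t₀ ht₀
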